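/- Let $n\ge 1$ and let $f:\mathbb{R}\to\mathbb{R}$ be an unbounded function satisfying $$\limsup_{u\to\infty}\frac{f(u)}{u^n}<\infty .$$ Then for any bounded domain (nonempty connected open set) $\Omega\subset\mathbb{R}^n$, in particular for any bounded convex domain, there is no convex large solution of $$\det D^2u=f(u)\quad\text{in }\Omega,$$ that is, no convex function $u:\Omega\to\mathbb{R}$ which solves this equation and satisfies $u(x)\to\infty$ as $x\to\partial\Omega$. If $\Omega$ is not convex, "$u$ is convex" means that $u$ is convex on every convex subset of $\Omega$. The statement holds both for classical solutions ($u\in C^2(\Omega)$, the equation holding pointwise) and for generalized (Aleksandrov) solutions, i.e. convex functions $u$ such that $f(u)$ is measurable, $f(u)\ge 0$ a.e. in $\Omega$, and the Lebesgue measure of $\partial u(E)=\bigcup_{x\in E}\partial u(x)$ equals $\int_E f(u(x))\,dx$ for every Borel set $E\subset\Omega$, where $\partial u(x)$ is the set of $p\in\mathbb{R}^n$ such that $u(y)\ge u(x)+p\cdot(y-x)$ for all $y$ near $x$. -/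

import Mathlib

open Set Filter Topology MeasureTheory

namespace MongeAmpere

/-- The Hessian matrix `D²u(x)` of second partial derivatives in the standard basis of `ℝⁿ`. -/
noncomputable def hessian {n : ℕ} (u : EuclideanSpace ℝ (Fin n) → ℝ)
    (x : EuclideanSpace ℝ (Fin n)) : Matrix (Fin n) (Fin n) ℝ :=
  Matrix.of fun i j =>
    fderiv ℝ (fderiv ℝ u) x (EuclideanSpace.single i 1) (EuclideanSpace.single j 1)

/-- A domain: a nonempty connected open set. -/
def IsDomain {n : ℕ} (Ω : Set (EuclideanSpace ℝ (Fin n))) : Prop :=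
  IsOpen Ω ∧ IsConnected Ω

/-- Convexity of `u` on a domain `Ω` which need not itself be convex: `u` is convex on every convex
subset of `Ω`. If `Ω` is convex, this is `ConvexOn ℝ Ω u`, see
`convexInDomain_iff_convexOn`. -/
def ConvexInDomain {n : ℕ} (Ω : Set (EuclideanSpace ℝ (Fin n)))
    (u : EuclideanSpace ℝ (Fin n) → ℝ) : Prop :=
  ∀ K ⊆ Ω, Convex ℝ K → ConvexOn ℝ K u

theorem convexInDomain_iff_convexOn {n : ℕ} {Ω : Set (EuclideanSpace ℝ (Fin n))}
    (hΩ : Convex ℝ Ω) (u : EuclideanSpace ℝ (Fin n) → ℝ) :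
    ConvexInDomain Ω u ↔ ConvexOn ℝ Ω u :=
  ⟨fun h => h Ω Subset.rfl hΩ, fun h _ hK hc => h.subset hK hc⟩

/-- The subdifferential `∂u(x)`: slopes `p` of affine functions that touch the graph of `u` from
below at `x`. For a function that is convex on a convex neighbourhood of `x`, an affine function
that supports it near `x` supports it on the whole neighbourhood, so on a convex domain this is
the usual (global) subdifferential. -/
def subdifferential {n : ℕ} (u : EuclideanSpace ℝ (Fin n) → ℝ) (x : EuclideanSpace ℝ (Fin n)) :
    Set (EuclideanSpace ℝ (Fin n)) :=
  {p | ∀ᶠ y in 𝓝 x, u x + inner ℝ p (y - x) ≤ u y}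

/-- `u` is a classical convex solution of `det D²u = f(u)` in `Ω`. -/
structure IsClassicalConvexSolution {n : ℕ} (f : ℝ → ℝ) (Ω : Set (EuclideanSpace ℝ (Fin n)))
    (u : EuclideanSpace ℝ (Fin n) → ℝ) : Prop where
  contDiffOn : ContDiffOn ℝ 2 u Ω
  convex : ConvexInDomain Ω u
  equation : ∀ x ∈ Ω, (hessian u x).det = f (u x)

/-- `u` is a generalized (Aleksandrov) convex solution of `det D²u = f(u)` in `Ω`: the
Monge-Ampère measure `E ↦ |∂u(E)|`, where `∂u(E)` is the union of the `∂u(x)` over `x ∈ E`, has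
the density `f(u)` with respect to Lebesgue measure on `Ω`. -/
structure IsAleksandrovConvexSolution {n : ℕ} (f : ℝ → ℝ) (Ω : Set (EuclideanSpace ℝ (Fin n)))
    (u : EuclideanSpace ℝ (Fin n) → ℝ) : Prop where
  convex : ConvexInDomain Ω u
  aemeasurable : AEMeasurable (fun x => f (u x)) (volume.restrict Ω)
  nonneg : ∀ᵐ x ∂(volume.restrict Ω), 0 ≤ f (u x)
  equation : ∀ E ⊆ Ω, MeasurableSet E →
    volume (⋃ x ∈ E, subdifferential u x) = ∫⁻ x in E, ENNReal.ofReal (f (u x))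

/-- The large condition `u(x) → ∞` as `x → ∂Ω`, `x ∈ Ω`. -/
def IsLarge {n : ℕ} (Ω : Set (EuclideanSpace ℝ (Fin n)))
    (u : EuclideanSpace ℝ (Fin n) → ℝ) : Prop :=
  ∀ z ∈ frontier Ω, Tendsto u (𝓝[Ω] z) atTop

end MongeAmpere

namespace MongeAmpere

/-! A large `u` on a domain of diameter at most `d` has many supporting slopes: tilting by `p` with
`‖p‖ < t / (2d)` still leaves a minimum inside `{u < t}` once `t ≥ 2 u(a)` and `t > 0`. So `∂u({u <
t})` has volume at least `ω (t / (2d))^n`, where `ω` is the volume of the unit ball. Fix a large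
level `T`. The part from `{u ≤ T}` is a finite constant, since that set is compact and `u` is
locally Lipschitz. The part from `{T < u < t}` is at most `C t^n |{u > T}|` by the growth of `f`.
Dividing by `t^n` and letting `t → ∞` gives `ω / (2d)^n ≤ C |{u > T}|`, and the right side vanishes
as `T → ∞`.

Only `|∂u(E)| ≤ ∫_E f(u)` is used. It is part of the definition for Aleksandrov solutions and
follows from the area inequality for the gradient map for classical ones. -/

/-! ### Local Lipschitz bounds and finiteness of the Monge-Ampère measure. -/

theorem ConvexInDomain.locallyLipschitzOn_ball {n : ℕ} {Ω : Set (EuclideanSpace ℝ (Fin n))}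
    {u : EuclideanSpace ℝ (Fin n) → ℝ} (hu : ConvexInDomain Ω u) {x : EuclideanSpace ℝ (Fin n)}
    {r : ℝ} (hr : Metric.ball x r ⊆ Ω) : LocallyLipschitzOn (Metric.ball x r) u :=
  (hu _ hr (convex_ball x r)).locallyLipschitzOn Metric.isOpen_ball

theorem ConvexInDomain.exists_lipschitzOnWith_nhds {n : ℕ}
    {Ω : Set (EuclideanSpace ℝ (Fin n))} (hΩ : IsOpen Ω)
    {u : EuclideanSpace ℝ (Fin n) → ℝ} (hu : ConvexInDomain Ω u)
    {x : EuclideanSpace ℝ (Fin n)} (hx : x ∈ Ω) :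
    ∃ K, ∃ s ∈ 𝓝 x, LipschitzOnWith K u s := by
  obtain ⟨r, hr, hball⟩ := Metric.isOpen_iff.1 hΩ x hx
  obtain ⟨K, s, hs, hK⟩ := hu.locallyLipschitzOn_ball hball (Metric.mem_ball_self hr)
  exact ⟨K, s, by rwa [Metric.isOpen_ball.nhdsWithin_eq (Metric.mem_ball_self hr)] at hs, hK⟩

theorem ConvexInDomain.continuousAt {n : ℕ} {Ω : Set (EuclideanSpace ℝ (Fin n))} (hΩ : IsOpen Ω)
    {u : EuclideanSpace ℝ (Fin n) → ℝ} (hu : ConvexInDomain Ω u)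
    {x : EuclideanSpace ℝ (Fin n)} (hx : x ∈ Ω) : ContinuousAt u x := by
  obtain ⟨K, s, hs, hK⟩ := hu.exists_lipschitzOnWith_nhds hΩ hx
  exact hK.continuousOn.continuousAt hs

/-- Slopes of supporting affine functions are bounded by a local Lipschitz constant. -/
theorem norm_le_of_mem_subdifferential {n : ℕ} {u : EuclideanSpace ℝ (Fin n) → ℝ}
    {x p : EuclideanSpace ℝ (Fin n)} {K : NNReal} {s : Set (EuclideanSpace ℝ (Fin n))}
    (hs : s ∈ 𝓝 x) (hK : LipschitzOnWith K u s) (hp : p ∈ subdifferential u x) : ‖p‖ ≤ K := by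
  have hlim : Tendsto (fun t : ℝ => x + t • p) (𝓝[>] 0) (𝓝 x) := by
    have h : Continuous (fun t : ℝ => x + t • p) := by fun_prop
    simpa using (h.tendsto 0).mono_left nhdsWithin_le_nhds
  -- A small step along `p` itself gives `t ‖p‖² ≤ u (x + t p) - u x ≤ K t ‖p‖`.
  obtain ⟨t, ⟨hsup, hts⟩, ht : 0 < t⟩ := ((hlim.eventually hp |>.and
    (hlim.eventually hs)).and self_mem_nhdsWithin).exists
  have hLip := hK.dist_le_mul _ hts _ (mem_of_mem_nhds hs)
  simp only [add_sub_cancel_left, inner_smul_right, real_inner_self_eq_norm_sq] at hsup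
  rw [Real.dist_eq, dist_eq_norm, add_sub_cancel_left, norm_smul, Real.norm_eq_abs,
    abs_of_pos ht] at hLip
  have h : t * ‖p‖ * ‖p‖ ≤ t * ‖p‖ * K := by
    nlinarith [le_abs_self (u (x + t • p) - u x)]
  by_contra! hlt
  exact absurd h (not_le.2 (mul_lt_mul_of_pos_left hlt
    (mul_pos ht (lt_of_le_of_lt K.coe_nonneg hlt))))

/-- The Monge-Ampère measure is finite on compact sets. -/
theorem ConvexInDomain.volume_subdifferential_lt_top {n : ℕ}
    {Ω : Set (EuclideanSpace ℝ (Fin n))} (hΩ : IsOpen Ω)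
    {u : EuclideanSpace ℝ (Fin n) → ℝ} (hu : ConvexInDomain Ω u)
    {S : Set (EuclideanSpace ℝ (Fin n))} (hS : IsCompact S) (hSΩ : S ⊆ Ω) :
    volume (⋃ x ∈ S, subdifferential u x) < ⊤ := by
  refine hS.induction_on (p := fun S => volume (⋃ x ∈ S, subdifferential u x) < ⊤) (by simp)
    (fun s t hst ht => (measure_mono (biUnion_subset_biUnion_left hst)).trans_lt ht)
    (fun s t hs ht => ?_) (fun x hx => ?_)
  · rw [biUnion_union]
    exact (measure_union_le _ _).trans_lt (ENNReal.add_lt_top.2 ⟨hs, ht⟩)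
  · obtain ⟨K, s, hs, hK⟩ := hu.exists_lipschitzOnWith_nhds hΩ (hSΩ hx)
    refine ⟨interior s, mem_nhdsWithin_of_mem_nhds (interior_mem_nhds.2 hs), ?_⟩
    refine (measure_mono (iUnion₂_subset fun y hy p hp => ?_)).trans_lt
      (measure_closedBall_lt_top (x := (0 : EuclideanSpace ℝ (Fin n))) (r := (K : ℝ)))
    rw [mem_closedBall_zero_iff]
    exact norm_le_of_mem_subdifferential (mem_interior_iff_mem_nhds.1 hy) hK hp

/-! ### Large functions: sublevel sets and supporting slopes. -/

theorem IsLarge.isCompact_sublevel {n : ℕ} {Ω : Set (EuclideanSpace ℝ (Fin n))}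
    (hΩ : Bornology.IsBounded Ω) {u : EuclideanSpace ℝ (Fin n) → ℝ}
    (hu : IsLarge Ω u) (hcont : ∀ x ∈ Ω, ContinuousAt u x) (t : ℝ) :
    IsCompact {x ∈ Ω | u x ≤ t} := by
  refine Metric.isCompact_of_isClosed_isBounded ?_ (hΩ.subset fun x hx => hx.1)
  refine isClosed_of_closure_subset fun z hz => ?_
  have : (𝓝[{x ∈ Ω | u x ≤ t}] z).NeBot := mem_closure_iff_nhdsWithin_neBot.1 hz
  have hle : ∀ᶠ x in 𝓝[{x ∈ Ω | u x ≤ t}] z, u x ≤ t :=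
    eventually_mem_nhdsWithin.mono fun x hx => hx.2
  by_cases hzΩ : z ∈ Ω
  · exact ⟨hzΩ, le_of_tendsto ((hcont z hzΩ).mono_left nhdsWithin_le_nhds) hle⟩
  · have hfr : z ∈ frontier Ω :=
      ⟨closure_mono (fun x hx => hx.1) hz, fun h => hzΩ (interior_subset h)⟩
    have hlim := (hu z hfr).mono_left (nhdsWithin_mono z fun x (hx : x ∈ {x ∈ Ω | u x ≤ t}) => hx.1)
    obtain ⟨x, hx, hx'⟩ := (hle.and (hlim.eventually_gt_atTop t)).exists
    exact absurd hx (not_le.2 hx')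

/-- The subdifferential of a large function contains the slopes of the cone with vertex
`(a, u a)` and height `t - u a`. -/
theorem IsLarge.ball_subset_biUnion_subdifferential {n : ℕ}
    {Ω : Set (EuclideanSpace ℝ (Fin n))} (hΩ : IsOpen Ω) (hΩ_bounded : Bornology.IsBounded Ω)
    {u : EuclideanSpace ℝ (Fin n) → ℝ} (hu : IsLarge Ω u)
    (hcont : ∀ x ∈ Ω, ContinuousAt u x) {d : ℝ} (hd : 0 < d)
    (hdiam : ∀ x ∈ Ω, ∀ y ∈ Ω, dist x y ≤ d) {a : EuclideanSpace ℝ (Fin n)} (ha : a ∈ Ω)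
    {r t : ℝ} (hr : 0 < r) (hrt : u a + r * d ≤ t) :
    Metric.ball 0 r ⊆ ⋃ x ∈ {x ∈ Ω | u x < t}, subdifferential u x := by
  intro p hp
  rw [mem_ball_zero_iff] at hp
  have hat : a ∈ {x ∈ Ω | u x ≤ t} := ⟨ha, by nlinarith⟩
  -- Where `u ≥ t` the tilted function exceeds its value at `a`, so its minimum over the compact
  -- sublevel set is attained in `{u < t}` and is a minimum over all of `Ω`.
  have hout : ∀ y ∈ Ω, t ≤ u y → u a < u y - inner ℝ p (y - a) := fun y hy hty => by
    have h1 : inner ℝ p (y - a) ≤ ‖p‖ * ‖y - a‖ := real_inner_le_norm _ _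
    have h2 : ‖y - a‖ ≤ d := by rw [← dist_eq_norm]; exact hdiam y hy a ha
    nlinarith [mul_le_mul_of_nonneg_left h2 (norm_nonneg p)]
  have hφ : ContinuousOn (fun y => u y - inner ℝ p (y - a)) {x ∈ Ω | u x ≤ t} := fun x hx =>
    ((hcont x hx.1).sub (by fun_prop)).continuousWithinAt
  obtain ⟨z, hz, hmin⟩ := (hu.isCompact_sublevel hΩ_bounded hcont t).exists_isMinOn ⟨a, hat⟩ hφ
  have hza : u z - inner ℝ p (z - a) ≤ u a := by simpa using hmin hat
  have hzt : u z < t := not_le.1 fun h => absurd hza (not_le.2 (hout z hz.1 h))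
  refine mem_biUnion (x := z) ⟨hz.1, hzt⟩ ?_
  filter_upwards [hΩ.mem_nhds hz.1] with y hy
  have hle : u z - inner ℝ p (z - a) ≤ u y - inner ℝ p (y - a) := by
    rcases le_total (u y) t with h | h
    · exact hmin ⟨hy, h⟩
    · exact hza.trans (hout y hy h).le
  have hsplit : y - z = (y - a) - (z - a) := by abel
  rw [hsplit, inner_sub_right]
  linarith

/-- If the Monge-Ampère measure of `u` is bounded above by the measure with density `f(u)` and `f`
grows at most like the `n`-th power, then `u` is not large on a bounded domain. -/
theorem not_isLarge_of_volume_le {n : ℕ} (hn : 1 ≤ n) {f : ℝ → ℝ} {C M : ℝ} (hC : 0 ≤ C)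
    (hf : ∀ t, M ≤ t → f t ≤ C * t ^ n)
    {Ω : Set (EuclideanSpace ℝ (Fin n))} (hΩ : IsDomain Ω) (hΩ_bounded : Bornology.IsBounded Ω)
    {u : EuclideanSpace ℝ (Fin n) → ℝ} (hconv : ConvexInDomain Ω u)
    (hle : ∀ E ⊆ Ω, MeasurableSet E →
      volume (⋃ x ∈ E, subdifferential u x) ≤ ∫⁻ x in E, ENNReal.ofReal (f (u x))) :
    ¬ IsLarge Ω u := by
  intro hu
  obtain ⟨hopen, ⟨a, ha⟩, -⟩ := hΩ
  have hcont : ∀ x ∈ Ω, ContinuousAt u x := fun x hx => hconv.continuousAt hopen hx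
  have hcontOn : ContinuousOn u Ω := fun x hx => (hcont x hx).continuousWithinAt
  obtain ⟨d, hd, hdiam⟩ : ∃ d > 0, ∀ x ∈ Ω, ∀ y ∈ Ω, dist x y ≤ d :=
    ⟨Metric.diam Ω + 1, by positivity, fun x hx y hy =>
      (Metric.dist_le_diam_of_mem hΩ_bounded hx hy).trans (by linarith)⟩
  set ω : ℝ := volume.real (Metric.ball (0 : EuclideanSpace ℝ (Fin n)) 1) with hω
  have hω_pos : 0 < ω := ENNReal.toReal_pos (Metric.measure_ball_pos _ _ one_pos).ne'
    measure_ball_lt_top.ne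
  have hsuper_open : ∀ T : ℝ, IsOpen {x ∈ Ω | T < u x} := fun T =>
    hcontOn.isOpen_inter_preimage hopen isOpen_Ioi
  have hΩ_fin : volume Ω ≠ ⊤ := hΩ_bounded.measure_lt_top.ne
  have hsuper_fin : ∀ T : ℝ, volume {x ∈ Ω | T < u x} ≠ ⊤ := fun T =>
    ne_top_of_le_ne_top hΩ_fin (measure_mono fun x hx => hx.1)
  have hbound : ∀ T, max M 1 ≤ T →
      ω / (2 * d) ^ n ≤ C * volume.real {x ∈ Ω | T < u x} := by
    intro T hT
    -- `A` is bounded by compactness and not through `f`, which is uncontrolled below `M`.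
    set A := volume (⋃ x ∈ {x ∈ Ω | u x ≤ T}, subdifferential u x)
    have hA : A ≠ ⊤ := (hconv.volume_subdifferential_lt_top hopen
      (hu.isCompact_sublevel hΩ_bounded hcont T) fun x hx => hx.1).ne
    have hlim : Tendsto (fun t : ℝ => A.toReal / t ^ n + C * volume.real {x ∈ Ω | T < u x}) atTop
        (𝓝 (0 + C * volume.real {x ∈ Ω | T < u x})) :=
      (Tendsto.div_atTop tendsto_const_nhds (tendsto_pow_atTop (by omega))).add_const _
    rw [zero_add] at hlim
    refine ge_of_tendsto hlim ?_
    filter_upwards [eventually_gt_atTop 0, eventually_ge_atTop (2 * u a)] with t ht hta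
    -- With this radius the tilt costs at most `t / 2`, and `u a ≤ t / 2` leaves room for it.
    have hsub := hu.ball_subset_biUnion_subdifferential hopen hΩ_bounded hcont hd hdiam ha
      (r := t / (2 * d)) (t := t) (by positivity) (by
        have : t / (2 * d) * d = t / 2 := by field_simp
        linarith)
    have hcover : {x ∈ Ω | u x < t} ⊆ {x ∈ Ω | u x ≤ T} ∪ ({x ∈ Ω | T < u x} ∩ {x ∈ Ω | u x < t}) :=
      fun x hx => (le_or_gt (u x) T).imp (fun h => ⟨hx.1, h⟩) (fun h => ⟨⟨hx.1, h⟩, hx⟩)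
    have hmeas : MeasurableSet ({x ∈ Ω | T < u x} ∩ {x ∈ Ω | u x < t}) :=
      (hsuper_open T).measurableSet.inter
        (hcontOn.isOpen_inter_preimage hopen isOpen_Iio).measurableSet
    have hupper : volume (⋃ x ∈ {x ∈ Ω | T < u x} ∩ {x ∈ Ω | u x < t}, subdifferential u x)
        ≤ ENNReal.ofReal (C * t ^ n) * volume {x ∈ Ω | T < u x} := by
      refine (hle _ (fun x hx => hx.1.1) hmeas).trans ?_
      refine (setLIntegral_mono' hmeas (g := fun _ => ENNReal.ofReal (C * t ^ n))
        fun x hx => ENNReal.ofReal_le_ofReal ?_).trans ?_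
      · have hux : T < u x := hx.1.2
        have h1 : 1 ≤ T := (le_max_right _ _).trans hT
        refine (hf _ (((le_max_left _ _).trans hT).trans hux.le)).trans ?_
        exact mul_le_mul_of_nonneg_left (pow_le_pow_left₀ (by linarith) hx.2.2.le n) hC
      · rw [setLIntegral_const]
        gcongr
        exact inter_subset_left
    have htotal : volume (Metric.ball (0 : EuclideanSpace ℝ (Fin n)) (t / (2 * d)))
        ≤ A + ENNReal.ofReal (C * t ^ n) * volume {x ∈ Ω | T < u x} := by
      refine (measure_mono (hsub.trans (biUnion_subset_biUnion_left hcover))).trans ?_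
      rw [biUnion_union]
      exact (measure_union_le _ _).trans (add_le_add_right hupper _)
    have hfin : ENNReal.ofReal (C * t ^ n) * volume {x ∈ Ω | T < u x} ≠ ⊤ :=
      ENNReal.mul_ne_top ENNReal.ofReal_ne_top (hsuper_fin T)
    have hreal := ENNReal.toReal_mono (ENNReal.add_ne_top.2 ⟨hA, hfin⟩) htotal
    rw [Measure.addHaar_ball_of_pos _ _ (by positivity), ENNReal.toReal_mul,
      ENNReal.toReal_add hA hfin, ENNReal.toReal_mul, finrank_euclideanSpace_fin,
      ENNReal.toReal_ofReal (by positivity), ENNReal.toReal_ofReal (by positivity)] at hreal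
    change (t / (2 * d)) ^ n * ω ≤ A.toReal + C * t ^ n * volume.real {x ∈ Ω | T < u x} at hreal
    have htn : 0 < t ^ n := by positivity
    rw [← mul_le_mul_iff_right₀ htn]
    calc t ^ n * (ω / (2 * d) ^ n) = (t / (2 * d)) ^ n * ω := by rw [div_pow]; ring
      _ ≤ A.toReal + C * t ^ n * volume.real {x ∈ Ω | T < u x} := hreal
      _ = t ^ n * (A.toReal / t ^ n + C * volume.real {x ∈ Ω | T < u x}) := by field_simp
  -- Since `u` is finite everywhere, the sets `{u > T}` decrease to the empty set.
  have hlim : Tendsto (fun T : ℝ => C * volume.real {x ∈ Ω | T < u x}) atTop (𝓝 (C * 0)) := by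
    refine Tendsto.const_mul C ?_
    have h := tendsto_measure_iInter_atTop (μ := volume) (s := fun T : ℝ => {x ∈ Ω | T < u x})
      (fun T => (hsuper_open T).measurableSet.nullMeasurableSet)
      (fun S T hST x hx => ⟨hx.1, hST.trans_lt hx.2⟩) ⟨0, hsuper_fin 0⟩
    have hempty : ⋂ T : ℝ, {x ∈ Ω | T < u x} = ∅ :=
      eq_empty_of_forall_notMem fun x hx => lt_irrefl _ (mem_iInter.1 hx (u x)).2
    rw [hempty, measure_empty] at h
    exact (ENNReal.tendsto_toReal ENNReal.zero_ne_top).comp h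
  rw [mul_zero] at hlim
  have h0 : ω / (2 * d) ^ n ≤ 0 :=
    ge_of_tendsto hlim ((eventually_ge_atTop (max M 1)).mono hbound)
  exact absurd h0 (not_le.2 (by positivity))

/-! ### Classical solutions: Hessian and gradient map. -/

/-- Along the line through `x` in direction `v`, convexity makes the first derivative monotone, so
its derivative at `0` is nonnegative. -/
theorem fderiv_fderiv_nonneg_of_convexOn_ball {n : ℕ} {u : EuclideanSpace ℝ (Fin n) → ℝ}
    {x : EuclideanSpace ℝ (Fin n)} {r : ℝ} (hr : 0 < r) (hconv : ConvexOn ℝ (Metric.ball x r) u)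
    (hdiff : ∀ y ∈ Metric.ball x r, DifferentiableAt ℝ u y)
    (hdiff2 : DifferentiableAt ℝ (fderiv ℝ u) x) (v : EuclideanSpace ℝ (Fin n)) :
    0 ≤ fderiv ℝ (fderiv ℝ u) x v v := by
  set L : ℝ →ᵃ[ℝ] EuclideanSpace ℝ (Fin n) := AffineMap.lineMap x (x + v) with hL
  have hL_apply : ∀ s : ℝ, L s = x + s • v := fun s => by
    simp [hL, AffineMap.lineMap_apply, add_comm]
  have hL0 : L 0 = x := by simp [hL_apply]
  have hL_deriv : ∀ s, HasDerivAt L v s := fun s => by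
    simpa [hL] using AffineMap.hasDerivAt_lineMap (a := x) (b := x + v) (x := s)
  have hS : L ⁻¹' Metric.ball x r ∈ 𝓝 (0 : ℝ) :=
    (hL_deriv 0).continuousAt.preimage_mem_nhds (by rw [hL0]; exact Metric.ball_mem_nhds x hr)
  have hg : ∀ s ∈ L ⁻¹' Metric.ball x r, HasDerivAt (u ∘ L) (fderiv ℝ u (L s) v) s := fun s hs =>
    (hdiff _ hs).hasFDerivAt.comp_hasDerivAt s (hL_deriv s)
  have hmono := (hconv.comp_affineMap L).monotoneOn_deriv fun s hs => (hg s hs).differentiableAt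
  have hg2 : HasDerivAt (fun s => fderiv ℝ u (L s) v) (fderiv ℝ (fderiv ℝ u) x v v) 0 := by
    have h := (hL0.symm ▸ hdiff2.hasFDerivAt :
      HasFDerivAt (fderiv ℝ u) (fderiv ℝ (fderiv ℝ u) x) (L 0)).comp_hasDerivAt 0 (hL_deriv 0)
    exact h.clm_apply (hasDerivAt_const 0 v) |>.congr_deriv (by simp)
  have hg2' : HasDerivAt (deriv (u ∘ L)) (fderiv ℝ (fderiv ℝ u) x v v) 0 :=
    hg2.congr_of_eventuallyEq (by filter_upwards [hS] with s hs using (hg s hs).deriv)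
  have h := hmono.derivWithin_nonneg (x := (0 : ℝ))
  rwa [derivWithin_of_mem_nhds hS, hg2'.deriv] at h

/-- The Riesz identification of the dual of `ℝⁿ` with `ℝⁿ`, as a linear map. -/
noncomputable def dualToEuclidean (n : ℕ) :
    (EuclideanSpace ℝ (Fin n) →L[ℝ] ℝ) →L[ℝ] EuclideanSpace ℝ (Fin n) :=
  LinearMap.toContinuousLinearMap
    { toFun := (InnerProductSpace.toDual ℝ (EuclideanSpace ℝ (Fin n))).symm
      map_add' := map_add _
      map_smul' := fun c l => by simp }

theorem dualToEuclidean_apply {n : ℕ} (l : EuclideanSpace ℝ (Fin n) →L[ℝ] ℝ) :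
    dualToEuclidean n l = (InnerProductSpace.toDual ℝ (EuclideanSpace ℝ (Fin n))).symm l := rfl

/-- The derivative of the gradient is the transpose of the Hessian. -/
theorem det_dualToEuclidean_comp_fderiv_fderiv {n : ℕ} (u : EuclideanSpace ℝ (Fin n) → ℝ)
    (x : EuclideanSpace ℝ (Fin n)) :
    (dualToEuclidean n ∘L fderiv ℝ (fderiv ℝ u) x).det = (hessian u x).det := by
  rw [ContinuousLinearMap.det, ← LinearMap.det_toMatrix
    (EuclideanSpace.basisFun (Fin n) ℝ).toBasis, ← Matrix.det_transpose (hessian u x)]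
  congr 1
  ext i j
  have h : ∀ w : EuclideanSpace ℝ (Fin n), w i = inner ℝ w (EuclideanSpace.single i (1 : ℝ)) := by
    simp [EuclideanSpace.inner_single_right]
  rw [LinearMap.toMatrix_apply]
  have happly := InnerProductSpace.toDual_symm_apply (𝕜 := ℝ)
    (x := EuclideanSpace.single i (1 : ℝ))
    (y := fderiv ℝ (fderiv ℝ u) x (EuclideanSpace.single j 1))
  rw [← h] at happly
  simpa [hessian, dualToEuclidean_apply] using happly

namespace IsClassicalConvexSolution

variable {n : ℕ} {f : ℝ → ℝ} {Ω : Set (EuclideanSpace ℝ (Fin n))}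
  {u : EuclideanSpace ℝ (Fin n) → ℝ}

theorem contDiffAt (hu : IsClassicalConvexSolution f Ω u) (hΩ : IsOpen Ω)
    {x : EuclideanSpace ℝ (Fin n)} (hx : x ∈ Ω) : ContDiffAt ℝ 2 u x :=
  hu.contDiffOn.contDiffAt (hΩ.mem_nhds hx)

theorem differentiableAt_fderiv (hu : IsClassicalConvexSolution f Ω u) (hΩ : IsOpen Ω)
    {x : EuclideanSpace ℝ (Fin n)} (hx : x ∈ Ω) : DifferentiableAt ℝ (fderiv ℝ u) x :=
  ((hu.contDiffAt hΩ hx).fderiv_right (m := 1) (by norm_num)).differentiableAt (by norm_num)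

theorem det_hessian_nonneg (hu : IsClassicalConvexSolution f Ω u) (hΩ : IsOpen Ω)
    {x : EuclideanSpace ℝ (Fin n)} (hx : x ∈ Ω) : 0 ≤ (hessian u x).det := by
  obtain ⟨r, hr, hball⟩ := Metric.isOpen_iff.1 hΩ x hx
  have hnonneg := fderiv_fderiv_nonneg_of_convexOn_ball hr (hu.convex _ hball (convex_ball x r))
    (fun y hy => (hu.contDiffAt hΩ (hball hy)).differentiableAt (by norm_num))
    (hu.differentiableAt_fderiv hΩ hx)
  refine (Matrix.PosSemidef.of_dotProduct_mulVec_nonneg ?_ fun c => ?_).det_nonneg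
  · ext i j
    exact (hu.contDiffAt hΩ hx).isSymmSndFDerivAt (by simp) _ _
  -- The quadratic form of the Hessian at `c` is the second derivative along the vector with
  -- coordinates `c`.
  · have h := hnonneg (∑ i, c i • EuclideanSpace.single i (1 : ℝ))
    simp only [map_sum, map_smul, sum_apply, smul_apply,
      smul_eq_mul, Finset.mul_sum] at h
    rw [Finset.sum_comm] at h
    simpa [hessian, dotProduct, Matrix.mulVec, Finset.mul_sum, mul_comm, mul_left_comm] using h

theorem subdifferential_subset (hu : IsClassicalConvexSolution f Ω u) (hΩ : IsOpen Ω)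
    {x : EuclideanSpace ℝ (Fin n)} (hx : x ∈ Ω) : subdifferential u x ⊆ {gradient u x} := by
  intro p hp
  have hd : HasFDerivAt u (fderiv ℝ u x) x :=
    ((hu.contDiffAt hΩ hx).differentiableAt (by norm_num)).hasFDerivAt
  have hmin : IsLocalMin (fun y => u y - innerSL ℝ p y) x := by
    filter_upwards [hp] with y hy
    simp only [innerSL_apply_apply]
    rw [inner_sub_right] at hy
    linarith
  have h := hmin.hasFDerivAt_eq_zero (hd.sub (innerSL ℝ p).hasFDerivAt)
  rw [mem_singleton_iff, gradient, sub_eq_zero.1 h]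
  exact ((InnerProductSpace.toDual ℝ _).symm_apply_apply p).symm

/-- Every supporting slope is a gradient, and the upper area inequality needs no injectivity of the
gradient map. Convexity removes the absolute value of the Jacobian. -/
theorem volume_subdifferential_le (hu : IsClassicalConvexSolution f Ω u) (hΩ : IsOpen Ω)
    {E : Set (EuclideanSpace ℝ (Fin n))} (hE : E ⊆ Ω) (hE_meas : MeasurableSet E) :
    volume (⋃ x ∈ E, subdifferential u x) ≤ ∫⁻ x in E, ENNReal.ofReal (f (u x)) := by
  have hsub : (⋃ x ∈ E, subdifferential u x) ⊆ gradient u '' E :=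
    iUnion₂_subset fun x hx p hp => ⟨x, hx, (hu.subdifferential_subset hΩ (hE hx) hp).symm⟩
  have hderiv : ∀ x ∈ E, HasFDerivWithinAt (gradient u)
      (dualToEuclidean n ∘L fderiv ℝ (fderiv ℝ u) x) E x := fun x hx =>
    ((dualToEuclidean n).hasFDerivAt.comp x
      (hu.differentiableAt_fderiv hΩ (hE hx)).hasFDerivAt).hasFDerivWithinAt
  refine (measure_mono hsub).trans
    ((addHaar_image_le_lintegral_abs_det_fderiv volume hE_meas hderiv).trans_eq ?_)
  refine setLIntegral_congr_fun hE_meas fun x hx => ?_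
  simp only [det_dualToEuclidean_comp_fderiv_fderiv]
  rw [abs_of_nonneg (hu.det_hessian_nonneg hΩ (hE hx)), hu.equation x (hE hx)]

end IsClassicalConvexSolution

theorem exists_le_mul_pow_of_limsup_lt_top {n : ℕ} {f : ℝ → ℝ}
    (hf : limsup (fun t : ℝ => ((f t / t ^ n : ℝ) : EReal)) atTop < ⊤) :
    ∃ C M : ℝ, 0 ≤ C ∧ ∀ t, M ≤ t → f t ≤ C * t ^ n := by
  obtain ⟨C, hC, -⟩ := EReal.lt_iff_exists_real_btwn.1 hf
  obtain ⟨M, hM⟩ := eventually_atTop.1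
    ((eventually_lt_of_limsup_lt hC).and (eventually_gt_atTop (0 : ℝ)))
  -- The limsup may be negative or `-∞`, so the constant is raised to at least `0`.
  refine ⟨max C 0, M, le_max_right _ _, fun t ht => ?_⟩
  obtain ⟨hlt, hpos⟩ := hM t ht
  rw [← div_le_iff₀ (by positivity)]
  exact (EReal.coe_lt_coe_iff.1 hlt).le.trans (le_max_left _ _)

end MongeAmpere

theorem theorem2p1 (n : ℕ) (hn : 1 ≤ n) (f : ℝ → ℝ)
    (hf_unbounded : ¬ Bornology.IsBounded (Set.range f))
    (hf_limsup : Filter.limsup (fun t : ℝ => ((f t / t ^ n : ℝ) : EReal)) Filter.atTop < ⊤)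
    (Ω : Set (EuclideanSpace ℝ (Fin n))) (hΩ : MongeAmpere.IsDomain Ω)
    (hΩ_bounded : Bornology.IsBounded Ω) :
    (¬ ∃ u : EuclideanSpace ℝ (Fin n) → ℝ,
        MongeAmpere.IsClassicalConvexSolution f Ω u ∧ MongeAmpere.IsLarge Ω u) ∧
      (¬ ∃ u : EuclideanSpace ℝ (Fin n) → ℝ,
        MongeAmpere.IsAleksandrovConvexSolution f Ω u ∧ MongeAmpere.IsLarge Ω u) := by
  obtain ⟨C, M, hC, hf⟩ := MongeAmpere.exists_le_mul_pow_of_limsup_lt_top hf_limsup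
  constructor
  · rintro ⟨u, hu, hlarge⟩
    exact MongeAmpere.not_isLarge_of_volume_le hn hC hf hΩ hΩ_bounded hu.convex
      (fun E hE hE_meas => hu.volume_subdifferential_le hΩ.1 hE hE_meas) hlarge
  · rintro ⟨u, hu, hlarge⟩
    exact MongeAmpere.not_isLarge_of_volume_le hn hC hf hΩ hΩ_bounded hu.convex
      (fun E hE hE_meas => (hu.equation E hE hE_meas).le) hlarge
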